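/- Let $\mathsf C$ and $\mathsf D$ be small categories and let $L:\mathsf C\rightleftarrows\mathsf D:U$ be an adjoint pair of functors, with $L$ left adjoint to $U$. Let $P:\mathsf C^{\mathrm{op}}\times\mathsf D\to\mathrm{Set}$ be the associated profunctor, $P(c,d)=\hom_{\mathsf D}(Lc,d)\ (\cong\hom_{\mathsf C}(c,Ud))$. Let $\mathsf J$ be the cograph of $P$, that is, the category whose objects are the disjoint union of the objects of $\mathsf C$ and of $\mathsf D$, whose hom sets are $$\hom_{\mathsf J}(c,c')=\hom_{\mathsf C}(c,c'),\quad \hom_{\mathsf J}(d,d')=\hom_{\mathsf D}(d,d'),\quad \hom_{\mathsf J}(c,d)=P(c,d),\quad \hom_{\mathsf J}(d,c)=\emptyset$$ for objects $c,c'$ of $\mathsf C$ and $d,d'$ of $\mathsf D$, and whose composition is given by composition in $\mathsf C$ and in $\mathsf D$ and by the actions of $\mathsf C$ and $\mathsf D$ on $P$. For a small category $\mathsf X$ let $B\mathsf X$ denote its classifying space, the geometric realization of the nerve of $\mathsf X$. Then there are homotopy equivalences $$B\mathsf C\simeq B\mathsf J\simeq B\mathsf D .$$ -/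

import Mathlib

open CategoryTheory Opposite
open scoped ContinuousMap

universe v u

/-- Objects of the cograph of a profunctor `P` from `D` to `C`, that is, of a functor
`Cᵒᵖ × D ⥤ Type` (in Mathlib's curried form `D ⥤ Cᵒᵖ ⥤ Type`): the disjoint union of the
objects of `C` and of `D`. -/
inductive Cograph {C D : Type u} [Category.{v} C] [Category.{v} D]
    (P : Profunctor.{v} D C) : Type u
  | left : C → Cograph P
  | right : D → Cograph P

namespace Cograph

variable {C D : Type u} [Category.{v} C] [Category.{v} D] {P : Profunctor.{v} D C}

/-- Morphisms of the cograph: those of `C`, those of `D`, and the heteromorphisms in `P(c, d)`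
from `c` to `d`; there are none from `d` to `c`. -/
def Hom : Cograph P → Cograph P → Type v
  | .left c, .left c' => c ⟶ c'
  | .right d, .right d' => d ⟶ d'
  | .left c, .right d => (P.obj d).obj (op c)
  | .right _, .left _ => PEmpty

/-- Identity morphisms of the cograph. -/
def id : ∀ x : Cograph P, Hom x x
  | .left c => 𝟙 c
  | .right d => 𝟙 d

/-- Composition in the cograph: composition in `C` and in `D`, and the actions of the morphisms
of `C` and of `D` on heteromorphisms. -/
def comp : ∀ {x y z : Cograph P}, Hom x y → Hom y z → Hom x z
  | .left c, .left c', .left c'', f, g =>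
      (show c ⟶ c' from f) ≫ (show c' ⟶ c'' from g)
  | .left c, .left c', .right d, f, φ =>
      (P.obj d).map (show c ⟶ c' from f).op φ
  | .left c, .right d, .right d', φ, g =>
      (P.map (show d ⟶ d' from g)).app (op c) φ
  | .right d, .right d', .right d'', f, g =>
      (show d ⟶ d' from f) ≫ (show d' ⟶ d'' from g)

/-- The cograph of a profunctor, as a category. -/
instance : Category.{v} (Cograph P) where
  Hom := Hom
  id := id
  comp := comp
  id_comp {x y} f := by
    cases x <;> cases y <;> first | exact PEmpty.elim f | skip
    · exact Category.id_comp (obj := C) f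
    · rename_i c d
      exact ConcreteCategory.congr_hom ((P.obj d).map_id (op c)) f
    · exact Category.id_comp (obj := D) f
  comp_id {x y} f := by
    cases x <;> cases y <;> first | exact PEmpty.elim f | skip
    · exact Category.comp_id (obj := C) f
    · rename_i c d
      exact ConcreteCategory.congr_hom (congr_app (P.map_id d) (op c)) f
    · exact Category.comp_id (obj := D) f
  assoc {w x y z} f g h := by
    cases w <;> cases x <;> cases y <;> cases z <;>
      first | exact PEmpty.elim f | exact PEmpty.elim g | exact PEmpty.elim h | skip
    · exact Category.assoc (obj := C) f g h
    · rename_i c c' c'' d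
      exact ConcreteCategory.congr_hom
        ((P.obj d).map_comp (Quiver.Hom.op (V := C) g) (Quiver.Hom.op (V := C) f)) h
    · exact NatTrans.naturality_apply (P.map h) (Quiver.Hom.op (V := C) f) g
    · rename_i c d d' d''
      exact (ConcreteCategory.congr_hom (congr_app (P.map_comp g h) (op c)) f).symm
    · exact Category.assoc (obj := D) f g h

end Cograph

/-- The classifying space of a category: the geometric realization of its nerve. -/
noncomputable def classifyingSpace (C : Type u) [Category.{v} C] : TopCat.{max u v} :=
  SSet.toTop.obj (nerve C)

/-! Write `J` for the cograph. The functor `J ⥤ D` that is `L` on `C` and the identity on `D` is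
left adjoint to the inclusion of `D` (`Cograph.collapseAdjunction`). An adjunction induces a
homotopy equivalence of classifying spaces, its unit and counit giving the homotopies. Applied to
this adjunction and to `L ⊣ U`, this gives `BJ ≃ BD` and `BC ≃ BD`, hence `BC ≃ BJ`.

A natural transformation is a functor on `C × Fin 2`, hence a simplicial homotopy of nerves. The
bulk of the work is `SSet.Homotopy.homotopic_toTop`: simplicially homotopic maps have homotopic
realizations. It is proved without comparing the realization of a product with the product of
realizations. A point `t` of a simplex is a partition of `[0, 1]`; cutting at `s` splits it into a
point of the join of two copies of the simplex. If `s` lies in the `i`-th interval, the first half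
is supported on vertices `≤ i` and the second on vertices `≥ i`, so truncating the two copies at `i`
prescribes a simplex of `X ⊗ Δ[1]`, to which the homotopy applies. The result is independent of `i`
on overlaps and natural in the simplex, so it descends to the realization. -/

namespace stdSimplex

/-! ### Pushforward and support of points of a simplex. -/

lemma map_apply_eq_sum {ι κ : Type*} [Fintype ι] [Fintype κ] [DecidableEq κ] (f : ι → κ)
    (t : stdSimplex ℝ ι) (j : κ) : map f t j = ∑ k with f k = j, t k := by
  rw [map_coe, FunOnFinite.linearMap_apply_apply]

/-- The total mass that `map f t` gives to a set is the mass of its preimage. -/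
lemma sum_map {ι κ : Type*} [Fintype ι] [Fintype κ] [DecidableEq ι] [DecidableEq κ] (f : ι → κ)
    (t : stdSimplex ℝ ι) (s : Finset κ) : ∑ j ∈ s, map f t j = ∑ k with f k ∈ s, t k := by
  simp_rw [map_apply_eq_sum]
  rw [← Finset.sum_biUnion]
  · congr 1
    ext k
    simp
  · intro j _ j' _ h
    rw [Function.onFun, Finset.disjoint_left]
    intro k hk hk'
    simp only [Finset.mem_filter, Finset.mem_univ, true_and] at hk hk'
    exact h (hk.symm.trans hk')

lemma map_eq_self {ι : Type*} [Fintype ι] (f : ι → ι) (t : stdSimplex ℝ ι)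
    (h : ∀ k, t k ≠ 0 → f k = k) : map f t = t := by
  classical
  ext j
  rw [map_apply_eq_sum, Finset.sum_filter]
  have : ∀ k, (if f k = j then t k else 0) = if k = j then t k else 0 := by
    intro k
    by_cases hk : t k = 0
    · simp [hk]
    · rw [h k hk]
  simp [this]

/-- Some monotone self-map of the vertices fixes `t` and takes values in the support of `t`. -/
lemma exists_monotone_map_eq_self {ι : Type*} [Fintype ι] [LinearOrder ι]
    (t : stdSimplex ℝ ι) :
    ∃ r : ι →o ι, map r t = t ∧ ∀ k, t (r k) ≠ 0 := by
  classical
  let S : Finset ι := Finset.univ.filter fun k ↦ t k ≠ 0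
  have hS : S.Nonempty := by
    by_contra h
    have h0 : ∀ k, t k = 0 := by
      intro k
      by_contra hk
      exact h ⟨k, by simpa [S] using hk⟩
    have := sum_eq_one t
    simp [h0] at this
  -- The map sends `k` to the largest support vertex `≤ k`; the `max` with the least support vertex
  -- covers those `k` lying below the whole support.
  let T : ι → Finset ι := fun k ↦ S.filter (· ≤ max k (S.min' hS))
  have hT : ∀ k, (T k).Nonempty := fun k ↦ ⟨S.min' hS, by
    exact Finset.mem_filter.2 ⟨S.min'_mem hS, le_max_right _ _⟩⟩
  refine ⟨⟨fun k ↦ (T k).max' (hT k), fun k l hkl ↦ ?_⟩, map_eq_self _ _ fun k hk ↦ ?_, fun k ↦ ?_⟩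
  · refine Finset.max'_subset _ fun x hx ↦ ?_
    simp only [T, Finset.mem_filter] at hx ⊢
    exact ⟨hx.1, hx.2.trans (max_le_max_right _ hkl)⟩
  · have hkS : k ∈ S := by simpa [S] using hk
    have hm : max k (S.min' hS) = k := max_eq_left (Finset.min'_le _ _ hkS)
    change (T k).max' (hT k) = k
    refine le_antisymm (Finset.max'_le _ _ _ fun x hx ↦ ?_) ((T k).le_max' k ?_)
    · simp only [T, hm, Finset.mem_filter] at hx
      exact hx.2
    · simp only [T, hm, Finset.mem_filter]
      exact ⟨hkS, le_rfl⟩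
  · have := (Finset.mem_filter.1 ((T k).max'_mem (hT k))).1
    exact (Finset.mem_filter.1 this).2

lemma sum_mono {ι : Type*} [Fintype ι] (t : stdSimplex ℝ ι) {A B : Finset ι} (h : A ⊆ B) :
    ∑ l ∈ A, t l ≤ ∑ l ∈ B, t l :=
  Finset.sum_le_sum_of_subset_of_nonneg h fun _ _ _ ↦ zero_le t _

/-! ### Cutting a partition of the unit interval. -/

section Cut

variable {ι : Type*} [Fintype ι] [LinearOrder ι] [LocallyFiniteOrderBot ι]

/-- Regard a point `t` of the simplex as a partition of `[0, 1]` into consecutive intervals of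
lengths `t k`. This is the length of the part of the `k`-th interval lying in `[0, s]`. -/
noncomputable def cut (t : stdSimplex ℝ ι) (s : ℝ) (k : ι) : ℝ :=
  min (∑ l ∈ Finset.Iic k, t l) s - min (∑ l ∈ Finset.Iio k, t l) s

lemma sum_Iic (t : stdSimplex ℝ ι) (k : ι) :
    ∑ l ∈ Finset.Iic k, t l = t k + ∑ l ∈ Finset.Iio k, t l := by
  rw [← Finset.Iio_insert, Finset.sum_insert (by simp)]

lemma cut_nonneg (t : stdSimplex ℝ ι) (s : ℝ) (k : ι) : 0 ≤ cut t s k := by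
  have := zero_le t k
  rw [cut, sum_Iic, sub_nonneg]
  exact min_le_min_right _ (by linarith)

lemma cut_le (t : stdSimplex ℝ ι) (s : ℝ) (k : ι) : cut t s k ≤ t k := by
  have := zero_le t k
  rw [cut, sum_Iic]
  grind

/-- The defining differences telescope along a lower set. -/
lemma sum_cut (t : stdSimplex ℝ ι) {s : ℝ} (hs : 0 ≤ s) (A : Finset ι)
    (hA : IsLowerSet (A : Set ι)) : ∑ k ∈ A, cut t s k = min (∑ k ∈ A, t k) s := by
  induction A using Finset.induction_on_max with
  | empty => simp [hs]
  | insert a A ha ih =>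
    have hA' : A = Finset.Iio a := by
      ext x
      rw [Finset.mem_Iio]
      refine ⟨ha x, fun hx ↦ ?_⟩
      have : x ∈ insert a A := hA hx.le (by simp)
      exact (Finset.mem_insert.1 this).resolve_left hx.ne
    have hlow : IsLowerSet (A : Set ι) := by
      rw [hA', Finset.coe_Iio]
      exact isLowerSet_Iio a
    have ha' : a ∉ A := fun h ↦ lt_irrefl a (ha a h)
    rw [Finset.sum_insert ha', Finset.sum_insert ha', ih hlow, cut, sum_Iic, hA']
    ring

lemma continuous_cut (k : ι) :
    Continuous fun p : stdSimplex ℝ ι × unitInterval ↦ cut p.1 p.2 k := by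
  have h : ∀ l : ι, Continuous fun p : stdSimplex ℝ ι × unitInterval ↦ p.1 l := fun l ↦
    (continuous_apply l).comp (continuous_subtype_val.comp continuous_fst)
  unfold cut
  fun_prop

/-- The parameters `(t, s)` such that `s` lies in the `i`-th interval of the partition `t`. -/
def piece (i : ι) : Set (stdSimplex ℝ ι × unitInterval) :=
  {p | ∑ l ∈ Finset.Iio i, p.1 l ≤ p.2 ∧ p.2 ≤ ∑ l ∈ Finset.Iic i, p.1 l}

lemma isClosed_piece (i : ι) : IsClosed (piece i) := by
  have h : ∀ l : ι, Continuous fun p : stdSimplex ℝ ι × unitInterval ↦ p.1 l := fun l ↦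
    (continuous_apply l).comp (continuous_subtype_val.comp continuous_fst)
  have h' (A : Finset ι) : Continuous fun p : stdSimplex ℝ ι × unitInterval ↦ ∑ l ∈ A, p.1 l := by
    fun_prop
  have hs : Continuous fun p : stdSimplex ℝ ι × unitInterval ↦ (p.2 : ℝ) := by fun_prop
  exact (isClosed_le (h' _) hs).inter (isClosed_le hs (h' _))

lemma cut_eq_zero {i : ι} {p : stdSimplex ℝ ι × unitInterval} (hp : p ∈ piece i) {k : ι}
    (hk : i < k) : cut p.1 p.2 k = 0 := by
  have h1 : ∑ l ∈ Finset.Iic i, p.1 l ≤ ∑ l ∈ Finset.Iio k, p.1 l :=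
    sum_mono _ fun x hx ↦ Finset.mem_Iio.2 ((Finset.mem_Iic.1 hx).trans_lt hk)
  have h2 := zero_le p.1 k
  have h3 := hp.2
  rw [cut, sum_Iic, min_eq_right (by linarith), min_eq_right (by linarith), sub_self]

lemma cut_eq {i : ι} {p : stdSimplex ℝ ι × unitInterval} (hp : p ∈ piece i) {k : ι}
    (hk : k < i) : cut p.1 p.2 k = p.1 k := by
  have h1 : ∑ l ∈ Finset.Iic k, p.1 l ≤ ∑ l ∈ Finset.Iio i, p.1 l :=
    sum_mono _ fun x hx ↦ Finset.mem_Iio.2 ((Finset.mem_Iic.1 hx).trans_lt hk)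
  have h2 := zero_le p.1 k
  have h3 := hp.1
  rw [sum_Iic] at h1
  rw [cut, sum_Iic, min_eq_left (by linarith), min_eq_left (by linarith), add_sub_cancel_right]

variable {κ : Type*} [Fintype κ] [LinearOrder κ] [LocallyFiniteOrderBot κ]

/-- Pushing forward merges the intervals over each fibre of `f`, so the merged interval at `f i`
contains the old one at `i`. -/
lemma map_mem_piece (f : ι →o κ) {i : ι} {p : stdSimplex ℝ ι × unitInterval} (hp : p ∈ piece i) :
    (map f p.1, p.2) ∈ piece (f i) := by
  refine ⟨le_trans ?_ hp.1, hp.2.trans ?_⟩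
  · rw [sum_map]
    refine sum_mono _ fun k hk ↦ ?_
    simp only [Finset.mem_Iio, Finset.mem_filter, Finset.mem_univ, true_and] at hk ⊢
    exact f.monotone.reflect_lt hk
  · rw [sum_map]
    refine sum_mono _ fun k hk ↦ ?_
    simp only [Finset.mem_Iic, Finset.mem_filter, Finset.mem_univ, true_and] at hk ⊢
    exact f.monotone hk

/-- For monotone `f` the preimages of `Iic j` and `Iio j` are lower sets, so `sum_cut` applies to
both; their difference is the fibre over `j`. -/
lemma cut_map (f : ι →o κ) (t : stdSimplex ℝ ι) {s : ℝ} (hs : 0 ≤ s) (j : κ) :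
    cut (map f t) s j = ∑ k with f k = j, cut t s k := by
  have h1 := sum_cut t hs (Finset.univ.filter fun k ↦ f k ∈ Finset.Iic j) (by
    intro a b hab ha
    simp only [Finset.mem_Iic, Finset.coe_filter, Finset.mem_univ, true_and,
      Set.mem_ofPred_eq] at ha ⊢
    exact (f.monotone hab).trans ha)
  have h2 := sum_cut t hs (Finset.univ.filter fun k ↦ f k ∈ Finset.Iio j) (by
    intro a b hab ha
    simp only [Finset.mem_Iio, Finset.coe_filter, Finset.mem_univ, true_and,
      Set.mem_ofPred_eq] at ha ⊢
    exact (f.monotone hab).trans_lt ha)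
  rw [cut, sum_map, sum_map, ← h1, ← h2, sub_eq_iff_eq_add, ← Finset.sum_union]
  · congr 1
    ext k
    simp only [Finset.mem_Iic, Finset.mem_Iio, Finset.mem_filter, Finset.mem_univ, true_and,
      Finset.mem_union]
    rw [le_iff_lt_or_eq, or_comm]
  · rw [Finset.disjoint_left]
    intro k hk hk'
    simp only [Finset.mem_Iio, Finset.mem_filter, Finset.mem_univ, true_and] at hk hk'
    exact hk'.ne hk

end Cut

/-- If no piece contains the point, a bound of `s` by the partial sum through `i` descends to the
predecessor of `i`, and finally contradicts `0 ≤ s`. Thus all partial sums are below `s`, including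
the total `1`. -/
lemma exists_mem_piece {n : ℕ} (p : stdSimplex ℝ (Fin (n + 1)) × unitInterval) :
    ∃ i, p ∈ piece i := by
  by_contra! h
  have key : ∀ i : Fin (n + 1), ∑ l ∈ Finset.Iic i, p.1 l < p.2 := by
    intro i
    by_contra! hi
    induction i using Fin.induction with
    | zero => exact h 0 ⟨by
        have : Finset.Iio (0 : Fin (n + 1)) = ∅ := by ext; simp
        rw [this]; simpa using p.2.2.1, hi⟩
    | succ i ih =>
      refine ih ?_
      have : Finset.Iio i.succ = Finset.Iic i.castSucc := by
        ext; simp [Fin.lt_def, Fin.le_def]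
      by_contra! h'
      exact h i.succ ⟨this ▸ h'.le, hi⟩
  have h1 := key (Fin.last n)
  have : Finset.Iic (Fin.last n) = Finset.univ := by ext; simp [Fin.le_last]
  rw [this, sum_eq_one] at h1
  exact absurd p.2.2.2 (not_le.2 h1)

/-- The two parts of each interval of the partition `t` cut at `s`, as a point of the simplex of
twice the size: first the parts in `[0, s]`, then those in `[s, 1]`. -/
noncomputable def split {n : ℕ} (p : stdSimplex ℝ (Fin n) × unitInterval) :
    stdSimplex ℝ (Fin (n + n)) :=
  ⟨Fin.append (fun k ↦ cut p.1 p.2 k) (fun k ↦ p.1 k - cut p.1 p.2 k), by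
    refine ⟨fun k ↦ ?_, ?_⟩
    · induction k using Fin.addCases with
      | left k => simpa using cut_nonneg p.1 p.2 k
      | right k => simpa [-Fin.natAdd_eq_addNat] using cut_le p.1 p.2 k
    · simp only [Fin.sum_univ_add, Fin.append_left, Fin.append_right, Finset.sum_sub_distrib,
        sum_eq_one, add_sub_cancel]⟩

@[simp]
lemma split_castAdd {n : ℕ} (p : stdSimplex ℝ (Fin n) × unitInterval) (k : Fin n) :
    split p (Fin.castAdd n k) = cut p.1 p.2 k := by
  change Fin.append (fun k ↦ cut p.1 p.2 k) (fun k ↦ p.1 k - cut p.1 p.2 k) _ = _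
  rw [Fin.append_left]

@[simp]
lemma split_natAdd {n : ℕ} (p : stdSimplex ℝ (Fin n) × unitInterval) (k : Fin n) :
    split p (Fin.natAdd n k) = p.1 k - cut p.1 p.2 k := by
  change Fin.append (fun k ↦ cut p.1 p.2 k) (fun k ↦ p.1 k - cut p.1 p.2 k) _ = _
  rw [Fin.append_right]

lemma continuous_split {n : ℕ} : Continuous (split (n := n)) := by
  refine Continuous.subtype_mk (continuous_pi fun k ↦ ?_) _
  have h : ∀ l, Continuous fun p : stdSimplex ℝ (Fin n) × unitInterval ↦ p.1 l := fun l ↦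
    (continuous_apply l).comp (continuous_subtype_val.comp continuous_fst)
  induction k using Fin.addCases with
  | left k => simpa using continuous_cut k
  | right k => simpa [-Fin.natAdd_eq_addNat] using! (h k).sub (continuous_cut k)

end stdSimplex

/-! ### Monotone maps on the join of two copies of a simplex. -/

namespace OrderHom

/-- The monotone map on the join (ordinal sum) of two copies of `Fin n` given by two monotone maps,
the first of which has values below those of the second. -/
def join {n : ℕ} {α : Type*} [Preorder α] (f g : Fin n →o α) (h : ∀ k l, f k ≤ g l) :
    Fin (n + n) →o α where
  toFun := Fin.append f g
  monotone' a b hab := by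
    induction a using Fin.addCases with
    | left a =>
      induction b using Fin.addCases with
      | left b =>
        rw [Fin.append_left, Fin.append_left]
        refine f.monotone (?_ : a ≤ b)
        simpa only [Fin.le_def, Fin.val_castAdd] using hab
      | right b =>
        rw [Fin.append_left, Fin.append_right]
        exact h a b
    | right a =>
      induction b using Fin.addCases with
      | left b =>
        simp only [Fin.le_def, Fin.val_castAdd, Fin.val_natAdd] at hab
        lia
      | right b =>
        rw [Fin.append_right, Fin.append_right]
        refine g.monotone (?_ : a ≤ b)
        simpa only [Fin.le_def, Fin.val_natAdd, add_le_add_iff_left] using hab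

section Join

variable {n : ℕ} {α : Type*} [Preorder α] (f g : Fin n →o α) (h : ∀ k l, f k ≤ g l) (k : Fin n)

@[simp]
lemma join_castAdd : join f g h (Fin.castAdd n k) = f k := by
  change Fin.append (f : Fin n → α) g _ = _
  rw [Fin.append_left]

@[simp]
lemma join_natAdd : join f g h (Fin.natAdd n k) = g k := by
  change Fin.append (f : Fin n → α) g _ = _
  rw [Fin.append_right]

end Join

/-- The monotone map on joins induced by two copies of a monotone map. -/
def double {n m : ℕ} (f : Fin n →o Fin m) : Fin (n + n) →o Fin (m + m) :=
  join ((Fin.castAddOrderEmb m).toOrderHom.comp f) ((Fin.natAddOrderEmb m).toOrderHom.comp f)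
    fun k l ↦ by
      simp only [comp_coe, Function.comp_apply, OrderEmbedding.toOrderHom_coe,
        Fin.castAddOrderEmb_apply, Fin.natAddOrderEmb_apply, Fin.le_def, Fin.val_castAdd,
        Fin.val_natAdd]
      lia

@[simp]
lemma double_castAdd {n m : ℕ} (f : Fin n →o Fin m) (k : Fin n) :
    f.double (Fin.castAdd n k) = Fin.castAdd m (f k) :=
  join_castAdd _ _ _ _

@[simp]
lemma double_natAdd {n m : ℕ} (f : Fin n →o Fin m) (k : Fin n) :
    f.double (Fin.natAdd n k) = Fin.natAdd m (f k) :=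
  join_natAdd _ _ _ _

/-- The monotone map from the join of two copies of `Fin n` that truncates the first copy from
above and the second one from below at `i`. -/
def clamp {n : ℕ} (i : Fin n) : Fin (n + n) →o Fin n :=
  join ⟨fun k ↦ min k i, fun _ _ h ↦ min_le_min_right i h⟩
    ⟨fun k ↦ max k i, fun _ _ h ↦ max_le_max_right i h⟩
    fun k l ↦ (min_le_right k i).trans (le_max_right l i)

@[simp]
lemma clamp_castAdd {n : ℕ} (i k : Fin n) : clamp i (Fin.castAdd n k) = min k i :=
  join_castAdd _ _ _ _

@[simp]
lemma clamp_natAdd {n : ℕ} (i k : Fin n) : clamp i (Fin.natAdd n k) = max k i :=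
  join_natAdd _ _ _ _

/-- The monotone map from the join of two copies of `Fin n` that tells the copies apart. -/
def side (n : ℕ) : Fin (n + n) →o Fin 2 :=
  join (OrderHom.const _ 0) (OrderHom.const _ 1) fun _ _ ↦ Fin.zero_le _

@[simp]
lemma side_castAdd {n : ℕ} (k : Fin n) : side n (Fin.castAdd n k) = 0 :=
  join_castAdd _ _ _ _

@[simp]
lemma side_natAdd {n : ℕ} (k : Fin n) : side n (Fin.natAdd n k) = 1 :=
  join_natAdd _ _ _ _

/-- Monotone maps of linear orders preserve `min` and `max`. -/
lemma clamp_comp_double {n m : ℕ} (f : Fin n →o Fin m) (i : Fin n) :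
    (clamp (f i)).comp f.double = f.comp (clamp i) := by
  ext k : 2
  induction k using Fin.addCases <;>
    simp [-Fin.natAdd_eq_addNat, f.monotone.map_min, f.monotone.map_max]

lemma side_comp_double {n m : ℕ} (f : Fin n →o Fin m) : (side m).comp f.double = side n := by
  ext k : 2
  induction k using Fin.addCases <;> simp [-Fin.natAdd_eq_addNat]

end OrderHom

/-! ### Naturality and endpoints of the splitting. -/

namespace stdSimplex

lemma split_map {n m : ℕ} (f : Fin n →o Fin m) (p : stdSimplex ℝ (Fin n) × unitInterval) :
    split (map f p.1, p.2) = map f.double (split p) := by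
  ext j
  rw [map_apply_eq_sum, Finset.sum_filter, Fin.sum_univ_add]
  induction j using Fin.addCases with
  | left j =>
    have h : ∀ k : Fin n, Fin.natAdd m (f k) ≠ Fin.castAdd m j := fun k h ↦ by
      have := congrArg Fin.val h
      simp only [Fin.val_castAdd, Fin.val_natAdd] at this
      lia
    simp [-Fin.natAdd_eq_addNat, cut_map f p.1 p.2.2.1, Finset.sum_filter, h]
  | right j =>
    have h : ∀ k : Fin n, Fin.castAdd m (f k) ≠ Fin.natAdd m j := fun k h ↦ by
      have := congrArg Fin.val h
      simp only [Fin.val_castAdd, Fin.val_natAdd] at this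
      lia
    simp [-Fin.natAdd_eq_addNat, cut_map f p.1 p.2.2.1, h, map_apply_eq_sum,
      ← Finset.sum_sub_distrib, ← Finset.sum_filter]

/-- On the overlap of two pieces, the two truncations agree on the support of `split p`. -/
lemma clamp_eq_clamp {n : ℕ} {i j : Fin n} {p : stdSimplex ℝ (Fin n) × unitInterval}
    (hi : p ∈ piece i) (hj : p ∈ piece j) {k : Fin (n + n)} (hk : split p k ≠ 0) :
    OrderHom.clamp i k = OrderHom.clamp j k := by
  induction k using Fin.addCases with
  | left k =>
    have h1 : k ≤ i := not_lt.1 fun h ↦ hk (by rw [split_castAdd, cut_eq_zero hi h])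
    have h2 : k ≤ j := not_lt.1 fun h ↦ hk (by rw [split_castAdd, cut_eq_zero hj h])
    simp [-Fin.natAdd_eq_addNat, h1, h2]
  | right k =>
    have h1 : i ≤ k := not_lt.1 fun h ↦ hk (by rw [split_natAdd, cut_eq hi h, sub_self])
    have h2 : j ≤ k := not_lt.1 fun h ↦ hk (by rw [split_natAdd, cut_eq hj h, sub_self])
    simp [-Fin.natAdd_eq_addNat, h1, h2]

lemma split_zero {n : ℕ} (t : stdSimplex ℝ (Fin n)) : split (t, 0) = map (Fin.natAdd n) t := by
  have h0 : ∀ k, cut t 0 k = 0 := fun k ↦ by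
    rw [cut, min_eq_right (Finset.sum_nonneg fun _ _ ↦ zero_le t _),
      min_eq_right (Finset.sum_nonneg fun _ _ ↦ zero_le t _), sub_self]
  ext j
  rw [map_apply_eq_sum]
  induction j using Fin.addCases with
  | left j =>
    rw [Finset.sum_eq_zero]
    · simp [-Fin.natAdd_eq_addNat, h0]
    · intro k hk
      have := congrArg Fin.val (Finset.mem_filter.1 hk).2
      simp only [Fin.val_castAdd, Fin.val_natAdd] at this
      lia
  | right j => simp [-Fin.natAdd_eq_addNat, h0, Finset.sum_filter]

lemma split_one {n : ℕ} (t : stdSimplex ℝ (Fin n)) : split (t, 1) = map (Fin.castAdd n) t := by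
  have h1 : ∀ A : Finset (Fin n), ∑ l ∈ A, t l ≤ 1 := fun A ↦
    (sum_mono t (Finset.subset_univ A)).trans (sum_eq_one t).le
  have h0 : ∀ k, cut t 1 k = t k := fun k ↦ by
    rw [cut, min_eq_left (h1 _), min_eq_left (h1 _), sum_Iic, add_sub_cancel_right]
  ext j
  rw [map_apply_eq_sum]
  induction j using Fin.addCases with
  | left j => simp [-Fin.natAdd_eq_addNat, h0, Finset.sum_filter]
  | right j =>
    rw [Finset.sum_eq_zero]
    · simp [-Fin.natAdd_eq_addNat, h0]
    · intro k hk
      have := congrArg Fin.val (Finset.mem_filter.1 hk).2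
      simp only [Fin.val_castAdd, Fin.val_natAdd] at this
      lia

lemma zero_mem_piece {n : ℕ} (t : stdSimplex ℝ (Fin (n + 1))) : (t, 0) ∈ piece 0 := by
  have : Finset.Iio (0 : Fin (n + 1)) = ∅ := by ext; simp
  exact ⟨by simp [-Fin.natAdd_eq_addNat, this], Finset.sum_nonneg fun _ _ ↦ zero_le t _⟩

lemma one_mem_piece {n : ℕ} (t : stdSimplex ℝ (Fin (n + 1))) : (t, 1) ∈ piece (Fin.last n) := by
  have : Finset.Iic (Fin.last n) = Finset.univ := by ext; simp [-Fin.natAdd_eq_addNat, Fin.le_last]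
  exact ⟨(sum_mono t (Finset.subset_univ _)).trans (sum_eq_one t).le, by simp [this]⟩

end stdSimplex

/-! ### Maps out of the realization, via the adjunction with singular simplices. -/

namespace SSet

open scoped Simplicial MonoidalCategory

/-- The continuous map from the standard topological simplex to the realization that is attached
to a simplex. -/
noncomputable def cell (Y : SSet.{u}) {n : SimplexCategory} (y : Y.obj (op n)) :
    C(_root_.stdSimplex ℝ (Fin (n.len + 1)), SSet.toTop.obj Y) :=
  TopCat.toSSetObjEquiv _ _ ((sSetTopAdj.unit.app Y).app (op n) y)

/-- The gluing relation of the realization, read off from naturality of the unit. -/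
lemma cell_map (Y : SSet.{u}) {m n : SimplexCategory} (f : m ⟶ n) (y : Y.obj (op n))
    (t : _root_.stdSimplex ℝ (Fin (m.len + 1))) :
    Y.cell (Y.map f.op y) t = Y.cell y (_root_.stdSimplex.map f.toOrderHom t) := by
  have h := ConcreteCategory.congr_hom ((sSetTopAdj.unit.app Y).naturality f.op) y
  exact DFunLike.congr_fun (congrArg (TopCat.toSSetObjEquiv _ _) h) t

lemma toTop_map_cell {X Y : SSet.{u}} (f : X ⟶ Y) {n : SimplexCategory} (x : X.obj (op n))
    (t : _root_.stdSimplex ℝ (Fin (n.len + 1))) :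
    SSet.toTop.map f (X.cell x t) = Y.cell (f.app _ x) t := by
  have h := sSetTopAdj.unit.naturality f
  have h' := ConcreteCategory.congr_hom (congr_app h (op n)) x
  exact (DFunLike.congr_fun (congrArg (TopCat.toSSetObjEquiv _ _) h') t).symm

/-- The map out of the realization given by a compatible family of maps out of simplices. -/
noncomputable def realizationDesc {X : SSet.{u}} {Z : TopCat.{u}} (g : ∀ ⦃n : SimplexCategory⦄,
      X.obj (op n) → C(_root_.stdSimplex ℝ (Fin (n.len + 1)), Z))
    (hg : ∀ ⦃m n : SimplexCategory⦄ (f : m ⟶ n) (x : X.obj (op n)) t,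
      g (X.map f.op x) t = g x (_root_.stdSimplex.map f.toOrderHom t)) :
    SSet.toTop.obj X ⟶ Z :=
  (sSetTopAdj.homEquiv X Z).symm
    { app n := ↾fun x ↦ (TopCat.toSSetObjEquiv Z n).symm (g (n := n.unop) x)
      naturality := fun n m f ↦ by
        ext x
        refine Eq.trans ?_ (TopCat.toSSetObjEquiv_symm_naturality f.unop (g (n := n.unop) x)).symm
        exact congrArg (TopCat.toSSetObjEquiv Z m).symm (ContinuousMap.ext (hg f.unop x)) }

lemma hom_apply_cell {X : SSet.{u}} {Z : TopCat.{u}} (φ : SSet.toTop.obj X ⟶ Z)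
    {n : SimplexCategory} (x : X.obj (op n)) (t : _root_.stdSimplex ℝ (Fin (n.len + 1))) :
    φ (X.cell x t) =
      TopCat.toSSetObjEquiv _ _ ((sSetTopAdj.homEquiv X Z φ).app (op n) x) t := by
  rw [Adjunction.homEquiv_unit]
  rfl

lemma realizationDesc_cell {X : SSet.{u}} {Z : TopCat.{u}} (g : ∀ ⦃n : SimplexCategory⦄,
      X.obj (op n) → C(_root_.stdSimplex ℝ (Fin (n.len + 1)), Z)) (hg)
    {n : SimplexCategory} (x : X.obj (op n)) (t : _root_.stdSimplex ℝ (Fin (n.len + 1))) :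
    realizationDesc g hg (X.cell x t) = g x t := by
  rw [hom_apply_cell, realizationDesc, Equiv.apply_symm_apply]
  exact DFunLike.congr_fun ((TopCat.toSSetObjEquiv Z (op n)).apply_symm_apply (g x)) t

lemma realization_hom_ext {X : SSet.{u}} {Z : TopCat.{u}} {φ ψ : SSet.toTop.obj X ⟶ Z}
    (h : ∀ ⦃n : SimplexCategory⦄ (x : X.obj (op n)) t, φ (X.cell x t) = ψ (X.cell x t)) :
    φ = ψ := by
  apply (sSetTopAdj.homEquiv X Z).injective
  ext n x
  apply (TopCat.toSSetObjEquiv _ _).injective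
  ext t
  exact (hom_apply_cell φ (n := n.unop) x t).symm.trans
    ((h (n := n.unop) x t).trans (hom_apply_cell ψ (n := n.unop) x t))

/-- Simplices that agree on the support of `t` have the same point at `t`. -/
lemma cell_congr {Y : SSet.{u}} {n : SimplexCategory} (y y' : Y.obj (op n))
    (t : _root_.stdSimplex ℝ (Fin (n.len + 1)))
    (h : ∀ r : n ⟶ n, (∀ k, t (r.toOrderHom k) ≠ 0) → Y.map r.op y = Y.map r.op y') :
    Y.cell y t = Y.cell y' t := by
  obtain ⟨r, hr, hr'⟩ := _root_.stdSimplex.exists_monotone_map_eq_self t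
  let f : n ⟶ n := SimplexCategory.Hom.mk r
  have key (z : Y.obj (op n)) : Y.cell z t = Y.cell (Y.map f.op z) t := by
    rw [cell_map]
    exact congrArg (Y.cell z) hr.symm
  rw [key y, key y', h f hr']

/-! ### Realizing a simplicial homotopy. -/

section Prism

/-- The map `OrderHom.clamp` in the simplex category. -/
def clampHom {n : SimplexCategory} (i : Fin (n.len + 1)) : ⦋n.len + 1 + n.len⦌ ⟶ n :=
  SimplexCategory.Hom.mk (OrderHom.clamp i)

/-- The map `OrderHom.double` in the simplex category. -/
def doubleHom {m n : SimplexCategory} (f : m ⟶ n) :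
    ⦋m.len + 1 + m.len⦌ ⟶ ⦋n.len + 1 + n.len⦌ :=
  SimplexCategory.Hom.mk f.toOrderHom.double

/-- The map `OrderHom.side` in the simplex category. -/
def sideHom (n : SimplexCategory) : ⦋n.len + 1 + n.len⦌ ⟶ ⦋1⦌ :=
  SimplexCategory.Hom.mk (OrderHom.side (n.len + 1))

lemma doubleHom_comp_clampHom {m n : SimplexCategory} (f : m ⟶ n) (i : Fin (m.len + 1)) :
    doubleHom f ≫ clampHom (f.toOrderHom i) = clampHom i ≫ f := by
  ext k : 3
  exact DFunLike.congr_fun (OrderHom.clamp_comp_double f.toOrderHom i) k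

lemma doubleHom_comp_sideHom {m n : SimplexCategory} (f : m ⟶ n) :
    doubleHom f ≫ sideHom n = sideHom m := by
  ext k : 3
  exact DFunLike.congr_fun (OrderHom.side_comp_double f.toOrderHom) k

variable {X Y : SSet.{u}} (H : X ⊗ Δ[1] ⟶ Y)

/-- The simplex of `Y` which the `i`-th piece of the prism over `x` is mapped to. -/
def prismSimplex {n : SimplexCategory} (x : X.obj (op n)) (i : Fin (n.len + 1)) :
    Y.obj (op ⦋n.len + 1 + n.len⦌) :=
  H.app (op ⦋n.len + 1 + n.len⦌)
    (X.map (clampHom i).op x, stdSimplex.objEquiv.symm (sideHom n))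

lemma map_prismSimplex {m n : SimplexCategory} (x : X.obj (op n)) (i : Fin (n.len + 1))
    (f : m ⟶ ⦋n.len + 1 + n.len⦌) :
    Y.map f.op (prismSimplex H x i) = H.app (op m)
      (X.map (f ≫ clampHom i).op x, stdSimplex.objEquiv.symm (f ≫ sideHom n)) := by
  refine (ConcreteCategory.congr_hom (H.naturality f.op) _).symm.trans
    (congrArg (H.app (op m)) (Prod.ext ?_ rfl))
  change X.map _ (X.map _ x) = X.map _ x
  rw [← Functor.map_comp_apply, op_comp]

lemma prismSimplex_map {m n : SimplexCategory} (f : m ⟶ n) (x : X.obj (op n))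
    (i : Fin (m.len + 1)) :
    prismSimplex H (X.map f.op x) i =
      Y.map (doubleHom f).op (prismSimplex H x (f.toOrderHom i)) := by
  rw [map_prismSimplex, doubleHom_comp_clampHom, doubleHom_comp_sideHom, prismSimplex,
    ← Functor.map_comp_apply, op_comp]

/-- The two truncations may differ as maps, but only off the support of `split p`, which
`cell_congr` ignores. -/
lemma cell_prismSimplex_congr {n : SimplexCategory} (x : X.obj (op n)) {i j : Fin (n.len + 1)}
    {p : _root_.stdSimplex ℝ (Fin (n.len + 1)) × unitInterval}
    (hi : p ∈ _root_.stdSimplex.piece i) (hj : p ∈ _root_.stdSimplex.piece j) :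
    Y.cell (prismSimplex H x i) (_root_.stdSimplex.split p) =
      Y.cell (prismSimplex H x j) (_root_.stdSimplex.split p) := by
  refine cell_congr _ _ _ fun r hr ↦ ?_
  have h : r ≫ clampHom i = r ≫ clampHom j := by
    ext k : 3
    exact _root_.stdSimplex.clamp_eq_clamp hi hj (hr k)
  rw [map_prismSimplex, map_prismSimplex, h]

/-- The homotopy on a single simplex `x`. -/
noncomputable def prismMap {n : SimplexCategory} (x : X.obj (op n))
    (p : _root_.stdSimplex ℝ (Fin (n.len + 1)) × unitInterval) : SSet.toTop.obj Y :=
  Y.cell (prismSimplex H x (_root_.stdSimplex.exists_mem_piece p).choose)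
    (_root_.stdSimplex.split p)

lemma prismMap_eq {n : SimplexCategory} (x : X.obj (op n)) {i : Fin (n.len + 1)}
    {p : _root_.stdSimplex ℝ (Fin (n.len + 1)) × unitInterval}
    (hi : p ∈ _root_.stdSimplex.piece i) :
    prismMap H x p = Y.cell (prismSimplex H x i) (_root_.stdSimplex.split p) :=
  cell_prismSimplex_congr H x (_root_.stdSimplex.exists_mem_piece p).choose_spec hi

/-- Pasting along the finite closed cover by pieces, on each of which the map is a cell composed
with `split`. -/
lemma continuous_prismMap {n : SimplexCategory} (x : X.obj (op n)) :
    Continuous (prismMap H x) := by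
  refine (locallyFinite_of_finite _).continuous
    (f := fun i : Fin (n.len + 1) ↦ _root_.stdSimplex.piece i)
    (Set.eq_univ_of_forall fun p ↦ Set.mem_iUnion.2 (_root_.stdSimplex.exists_mem_piece p))
    (fun i ↦ _root_.stdSimplex.isClosed_piece i) fun i ↦ ?_
  exact ((Y.cell (prismSimplex H x i)).continuous.comp
    _root_.stdSimplex.continuous_split).continuousOn.congr fun p hp ↦ prismMap_eq H x hp

lemma prismMap_map {m n : SimplexCategory} (f : m ⟶ n) (x : X.obj (op n))
    (p : _root_.stdSimplex ℝ (Fin (m.len + 1)) × unitInterval) :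
    prismMap H (X.map f.op x) p = prismMap H x (_root_.stdSimplex.map f.toOrderHom p.1, p.2) := by
  obtain ⟨i, hi⟩ := _root_.stdSimplex.exists_mem_piece p
  rw [prismMap_eq H _ hi, prismMap_eq H x (_root_.stdSimplex.map_mem_piece f.toOrderHom hi),
    prismSimplex_map, cell_map]
  exact congrArg _ (_root_.stdSimplex.split_map f.toOrderHom p).symm

lemma prismMap_zero {n : SimplexCategory} (x : X.obj (op n))
    (t : _root_.stdSimplex ℝ (Fin (n.len + 1))) :
    prismMap H x (t, 0) = Y.cell ((ι₁ ≫ H).app _ x) t := by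
  let f : n ⟶ ⦋n.len + 1 + n.len⦌ :=
    SimplexCategory.Hom.mk (Fin.natAddOrderEmb (n.len + 1)).toOrderHom
  have h1 : f ≫ clampHom 0 = 𝟙 n := by
    ext k : 3
    exact (OrderHom.clamp_natAdd 0 k).trans (max_eq_left (Fin.zero_le k))
  have h2 : stdSimplex.objEquiv.symm (f ≫ sideHom n) = (ι₁.app (op n) x).2 := by
    refine stdSimplex.objEquiv.injective ?_
    ext k : 3
    exact OrderHom.side_natAdd k
  have h3 : (ι₁ ≫ H).app _ x = Y.map f.op (prismSimplex H x 0) := by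
    rw [map_prismSimplex, h1, h2, op_id, Functor.map_id_apply]
    rfl
  rw [prismMap_eq H x (_root_.stdSimplex.zero_mem_piece t), _root_.stdSimplex.split_zero, h3,
    cell_map]
  rfl

lemma prismMap_one {n : SimplexCategory} (x : X.obj (op n))
    (t : _root_.stdSimplex ℝ (Fin (n.len + 1))) :
    prismMap H x (t, 1) = Y.cell ((ι₀ ≫ H).app _ x) t := by
  let f : n ⟶ ⦋n.len + 1 + n.len⦌ :=
    SimplexCategory.Hom.mk (Fin.castAddOrderEmb (n.len + 1)).toOrderHom
  have h1 : f ≫ clampHom (Fin.last n.len) = 𝟙 n := by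
    ext k : 3
    exact (OrderHom.clamp_castAdd _ k).trans (min_eq_left (Fin.le_last k))
  have h2 : stdSimplex.objEquiv.symm (f ≫ sideHom n) = (ι₀.app (op n) x).2 := by
    refine stdSimplex.objEquiv.injective ?_
    ext k : 3
    exact OrderHom.side_castAdd k
  have h3 : (ι₀ ≫ H).app _ x = Y.map f.op (prismSimplex H x (Fin.last n.len)) := by
    rw [map_prismSimplex, h1, h2, op_id, Functor.map_id_apply]
    rfl
  rw [prismMap_eq H x (_root_.stdSimplex.one_mem_piece t), _root_.stdSimplex.split_one, h3,
    cell_map]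
  rfl

/-- The map on the realization of `X`, with values in paths in the realization of `Y`,
induced by a simplicial homotopy. -/
noncomputable def prismRealization :
    SSet.toTop.obj X ⟶ TopCat.of C(unitInterval, SSet.toTop.obj Y) :=
  -- Currying puts the time parameter in the target, so that the universal property of the
  -- realization applies directly.
  realizationDesc (fun _ x ↦ ContinuousMap.curry ⟨prismMap H x, continuous_prismMap H x⟩)
    fun _ _ f x t ↦ ContinuousMap.ext fun s ↦ prismMap_map H f x (t, s)

lemma prismRealization_apply (s : unitInterval) {f : X ⟶ Y}
    (h : ∀ ⦃n : SimplexCategory⦄ (x : X.obj (op n)) t,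
      prismMap H x (t, s) = Y.cell (f.app _ x) t) (z : SSet.toTop.obj X) :
    (prismRealization H z : C(unitInterval, SSet.toTop.obj Y)) s = SSet.toTop.map f z := by
  let ev : TopCat.of C(unitInterval, SSet.toTop.obj Y) ⟶ SSet.toTop.obj Y :=
    TopCat.ofHom ⟨fun γ ↦ γ s, continuous_eval_const s⟩
  have key : prismRealization H ≫ ev = SSet.toTop.map f := by
    refine realization_hom_ext fun n x t ↦ ?_
    rw [toTop_map_cell, ← h]
    exact DFunLike.congr_fun (realizationDesc_cell (X := X)
      (Z := TopCat.of C(unitInterval, SSet.toTop.obj Y)) _ _ x t) s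
  exact ConcreteCategory.congr_hom key z

/-- Simplicially homotopic maps have homotopic realizations. -/
theorem Homotopy.homotopic_toTop {f g : X ⟶ Y} (h : Homotopy f g) :
    (SSet.toTop.map f).hom.Homotopic (SSet.toTop.map g).hom := by
  -- At time `0` all mass is in the second copy, over vertex `1` of `Δ[1]`, so the constructed
  -- homotopy runs from `g` to `f`.
  refine ContinuousMap.Homotopic.symm ⟨⟨⟨fun p ↦
    (prismRealization h.h p.2 : C(unitInterval, SSet.toTop.obj Y)) p.1, ?_⟩, fun z ↦ ?_,
      fun z ↦ ?_⟩⟩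
  · exact ((prismRealization h.h).hom.continuous.comp continuous_snd).eval continuous_fst
  · exact prismRealization_apply h.h 0 (fun n x t ↦ by rw [prismMap_zero, h.h₁]) z
  · exact prismRealization_apply h.h 1 (fun n x t ↦ by rw [prismMap_one, h.h₀]) z

end Prism

end SSet

/-! ### Natural transformations and adjunctions on classifying spaces. -/

namespace CategoryTheory

variable {C D : Type u} [Category.{v} C] [Category.{v} D]

/-- The functor from the cylinder on `C` that corresponds to a natural transformation. -/
def NatTrans.cylinder {F G : C ⥤ D} (α : F ⟶ G) : C × Fin 2 ⥤ D :=
  Functor.uncurry.obj (ComposableArrows.mk₁ α).flip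

/-- A natural transformation induces a simplicial homotopy between maps of nerves. -/
noncomputable def NatTrans.nerveHomotopy {F G : C ⥤ D} (α : F ⟶ G) :
    SSet.Homotopy (nerveMap F) (nerveMap G) where
  h :=
    { app n := ↾fun x ↦ Functor.prod' x.1 (SSet.stdSimplex.asOrderHom x.2).monotone.functor ⋙
        α.cylinder
      naturality _ _ _ := rfl }
  h₀ := by
    ext n x
    refine Functor.ext (fun _ ↦ rfl) fun i j f ↦ ?_
    -- On arrows the cylinder inserts an extra identity from the constant `Fin 2` coordinate; `h`
    -- removes it.
    have h : ((ComposableArrows.mk₁ α).map (𝟙 (0 : Fin 2))).app (x.obj j) = 𝟙 (F.obj (x.obj j)) :=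
      congr_app ((ComposableArrows.mk₁ α).map_id (0 : Fin 2)) (x.obj j)
    exact (congrArg (F.map (x.map f) ≫ ·) h).trans
      (Category.id_comp (F.map (x.map f) ≫ 𝟙 _)).symm
  h₁ := by
    ext n x
    refine Functor.ext (fun _ ↦ rfl) fun i j f ↦ ?_
    have h : ((ComposableArrows.mk₁ α).map (𝟙 (1 : Fin 2))).app (x.obj j) = 𝟙 (G.obj (x.obj j)) :=
      congr_app ((ComposableArrows.mk₁ α).map_id (1 : Fin 2)) (x.obj j)
    exact (congrArg (G.map (x.map f) ≫ ·) h).trans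
      (Category.id_comp (G.map (x.map f) ≫ 𝟙 _)).symm
  rel := by
    -- The homotopy is relative to the empty subcomplex, which has no simplices.
    ext _ ⟨⟨_, ⟨⟩⟩, _⟩

theorem homotopic_of_natTrans {F G : C ⥤ D} (α : F ⟶ G) :
    (SSet.toTop.map (nerveMap F)).hom.Homotopic (SSet.toTop.map (nerveMap G)).hom :=
  α.nerveHomotopy.homotopic_toTop

/-- The map of classifying spaces induced by a functor. -/
noncomputable def Functor.mapClassifyingSpace (F : C ⥤ D) :
    C(classifyingSpace C, classifyingSpace D) :=
  (SSet.toTop.map (nerveMap F)).hom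

/-- An adjunction induces a homotopy equivalence of classifying spaces. -/
noncomputable def Adjunction.classifyingSpaceHomotopyEquiv {L : C ⥤ D} {U : D ⥤ C} (adj : L ⊣ U) :
    classifyingSpace C ≃ₕ classifyingSpace D where
  toFun := L.mapClassifyingSpace
  invFun := U.mapClassifyingSpace
  left_inv := by
    have h := homotopic_of_natTrans adj.unit
    have h1 : nerveMap (𝟭 C) = 𝟙 (nerve C) := rfl
    have h2 : nerveMap (L ⋙ U) = nerveMap L ≫ nerveMap U := rfl
    rw [h1, h2, Functor.map_id, Functor.map_comp] at h
    exact h.symm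
  right_inv := by
    have h := homotopic_of_natTrans adj.counit
    have h1 : nerveMap (𝟭 D) = 𝟙 (nerve D) := rfl
    have h2 : nerveMap (U ⋙ L) = nerveMap U ≫ nerveMap L := rfl
    rw [h1, h2, Functor.map_id, Functor.map_comp] at h
    exact h

end CategoryTheory

/-! ### The cograph retracts onto the second category. -/

namespace Cograph

variable {C D : Type u} [Category.{v} C] [Category.{v} D]

/-- The inclusion of the second category into the cograph. -/
def inclRight (P : Profunctor.{v} D C) : D ⥤ Cograph P where
  obj d := .right d
  map f := f
  map_id _ := rfl
  map_comp _ _ := rfl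

/-- The functor from the cograph of the profunctor `hom (L -, -)` to `D` that is `L` on `C` and the
identity on `D`. -/
def collapse (L : C ⥤ D) : Cograph L.toProfunctorRev ⥤ D where
  obj
    | .left c => L.obj c
    | .right d => d
  map {x y} f :=
    match x, y, f with
    | .left _, .left _, f => L.map f
    -- A heteromorphism from `c` to `d` is by definition an arrow `L c ⟶ d`.
    | .left _, .right _, f => f
    | .right _, .right _, f => f
  map_id x := by
    cases x
    · exact L.map_id _
    · rfl
  map_comp {x y z} f g := by
    cases x <;> cases y <;> cases z <;>
      first | exact PEmpty.elim f | exact PEmpty.elim g | skip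
    · exact L.map_comp _ _
    · rfl
    · rfl
    · rfl

/-- The inclusion of `D` into the cograph is right adjoint to `collapse L`. -/
def collapseAdjunction (L : C ⥤ D) : collapse L ⊣ inclRight L.toProfunctorRev where
  unit :=
    { app x := match x with
        -- The identity of `L c`, viewed as a heteromorphism from `c` to `L c`: the universal arrow
        -- from `c` into `D`.
        | .left c => 𝟙 (L.obj c)
        | .right d => 𝟙 d
      naturality x y f := by
        cases x <;> cases y <;>
          first | exact PEmpty.elim f | skip
        · exact (Category.comp_id (L.map _)).trans (Category.id_comp (L.map _)).symm
        · exact (Category.comp_id (obj := D) _).trans (Category.id_comp (obj := D) _).symm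
        · exact (Category.comp_id (obj := D) _).trans (Category.id_comp (obj := D) _).symm }
  counit := 
    { app d := 𝟙 d
      naturality _ _ f := (Category.comp_id f).trans (Category.id_comp f).symm }
  left_triangle_components x := by
    cases x
    · exact Category.comp_id (obj := D) _
    · exact Category.comp_id (obj := D) _
  right_triangle_components d := Category.comp_id (obj := D) _

end Cograph

theorem theorem5p1 {C D : Type u} [Category.{v} C] [Category.{v} D]
    (L : C ⥤ D) (U : D ⥤ C) (adj : L ⊣ U) :
    Nonempty (classifyingSpace C ≃ₕ classifyingSpace (Cograph L.toProfunctorRev)) ∧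
      Nonempty (classifyingSpace (Cograph L.toProfunctorRev) ≃ₕ classifyingSpace D) := by
  have e := (Cograph.collapseAdjunction L).classifyingSpaceHomotopyEquiv
  exact ⟨⟨adj.classifyingSpaceHomotopyEquiv.trans e.symm⟩, ⟨e⟩⟩
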